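/- **Conventions.** Permutations of $[n]=\{1,\dots,n\}$ ($n\ge 0$) are written as words $\pi(1)\pi(2)\cdots\pi(n)$. On words with distinct letters, the stack sorting operator $\mathbf S$ is defined by $\mathbf S(\varepsilon)=\varepsilon$ and $\mathbf S(\alpha\, m\,\beta)=\mathbf S(\alpha)\,\mathbf S(\beta)\,m$, where $m$ is the largest letter; $\mathbf R$ is the reversal operator. A permutation $\theta$ of $[n]$ is *sorted by* an operator $\mathbf B$ if $\mathbf B(\theta)=1\,2\cdots n$. For permutations $\alpha$ of $[a]$ and $\beta$ of $[b]$, let $\alpha\oplus\beta=\alpha\,(\beta+a)$ and $\alpha\ominus\beta=(\alpha+b)\,\beta$. The map $P$ on $231$-avoiding permutations is defined by $P(\varepsilon)=\varepsilon$ and $P(\alpha\oplus(1\ominus\beta))=(P(\alpha)\oplus 1)\ominus P(\beta)$, and for a $231$-avoiding permutation $\pi$ of $[n]$, $\lambda_\pi$ is the permutation of $[n]$ with $P(\pi)=\lambda_\pi\circ\pi$. For a composition $\mathbf A$ of operators from $\{\mathbf S,\mathbf R\}$ and a permutation $\theta$ sorted by $\mathbf S\circ\mathbf A$ (so that $\mathbf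 A(\theta)$ avoids $231$), set $\Phi_{\mathbf A}(\theta)=\lambda_{\mathbf A(\theta)}\circ\theta$. For a permutation $\pi$ of $[n]$ let $$\mathrm{zeil}(\pi)=\max\{k\le n : n(n-1)\cdots(n-k+1)\text{ is a subword of }\pi\},$$ $$\mathrm{Rzeil}(\pi)=\max\{k\le n : (n-k+1)\cdots(n-1)n\text{ is a subword of }\pi\}$$ (subwords need not be consecutive). **Theorem.** Let $\mathbf A=\mathbf A_0\circ\mathbf S$, where $\mathbf A_0$ is an arbitrary (possibly empty) composition of operators from $\{\mathbf S,\mathbf R\}$. 1. $\Phi_{\mathbf A}$ preserves $\mathrm{zeil}$: $\mathrm{zeil}(\Phi_{\mathbf A}(\theta))=\mathrm{zeil}(\theta)$ for every permutation $\theta$ sorted by $\mathbf S\circ\mathbf A$. 2. If moreover the composition defining $\mathbf A_0$, after cancelling all factors $\mathbf R\circ\mathbf R=\mathrm{id}$ until no two consecutive $\mathbf R$'s remain, contains two consecutive operators $\mathbf S\circ\mathbf R$ (with $\mathbf R$ applied immediately before $\mathbf S$), then $\Phi_{\mathbf A}$ also preserves $\mathrm{Rzeil}$: $\mathrm{Rzeil}(\Phi_{\mathbf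 A}(\theta))=\mathrm{Rzeil}(\theta)$ for every permutation $\theta$ sorted by $\mathbf S\circ\mathbf A$. -/

import Mathlib

namespace StackSort

/-- A permutation of `[n] = {1, …, n}` in one-line notation `π(1) π(2) … π(n)`. -/
def IsPerm (n : ℕ) (π : List ℕ) : Prop := π.Perm (List.range' 1 n)

/-- The maximum of a word of natural numbers (`0` for the empty word). -/
def maxEntry (w : List ℕ) : ℕ := w.foldr max 0

/-- If `w = α m β` with `m` the maximum of `w` (and `m ∉ α`), this is `α`. -/
def beforeMax (w : List ℕ) : List ℕ := w.take (w.idxOf (maxEntry w))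

/-- If `w = α m β` with `m` the maximum of `w` (and `m ∉ α`), this is `β`. -/
def afterMax (w : List ℕ) : List ℕ := w.drop (w.idxOf (maxEntry w) + 1)

theorem maxEntry_mem {w : List ℕ} (hw : w ≠ []) : maxEntry w ∈ w := by
  induction w with
  | nil => exact absurd rfl hw
  | cons a l ih =>
    change max a (maxEntry l) ∈ a :: l
    rcases eq_or_ne l [] with rfl | hl
    · simp [maxEntry]
    · rcases max_choice a (maxEntry l) with h | h
      · rw [h]; simp
      · rw [h]; exact List.mem_cons_of_mem _ (ih hl)

theorem length_beforeMax_lt {w : List ℕ} (hw : w ≠ []) :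
    (beforeMax w).length < w.length := by
  have h := List.idxOf_lt_length_of_mem (maxEntry_mem hw)
  simp only [beforeMax, List.length_take]
  omega

theorem length_afterMax_lt {w : List ℕ} (hw : w ≠ []) :
    (afterMax w).length < w.length := by
  have h := List.idxOf_lt_length_of_mem (maxEntry_mem hw)
  simp only [afterMax, List.length_drop]
  omega

theorem beforeMax_append_afterMax {w : List ℕ} (hw : w ≠ []) :
    beforeMax w ++ maxEntry w :: afterMax w = w := by
  have h := List.idxOf_lt_length_of_mem (maxEntry_mem hw)
  have h2 : w[w.idxOf (maxEntry w)] = maxEntry w := List.getElem_idxOf h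
  conv_rhs => rw [← List.take_append_drop (w.idxOf (maxEntry w)) w,
    List.drop_eq_getElem_cons h, h2]
  rfl

/-- The stack sorting operator: `S(ε) = ε` and `S(α m β) = S(α) S(β) m`, with `m` the maximum. -/
def stackSort (w : List ℕ) : List ℕ :=
  if _h : w = [] then []
  else stackSort (beforeMax w) ++ stackSort (afterMax w) ++ [maxEntry w]
termination_by w.length
decreasing_by
  · exact length_beforeMax_lt _h
  · exact length_afterMax_lt _h

/-- The direct sum `α ⊕ β = α (β + |α|)`. -/
def oplus (α β : List ℕ) : List ℕ := α ++ β.map (· + α.length)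

/-- The skew sum `α ⊖ β = (α + |β|) β`. -/
def ominus (α β : List ℕ) : List ℕ := α.map (· + β.length) ++ β

/-- The map `P`, which is used on `231`-avoiding permutations `π` of `[n]` only. Such a nonempty `π`
is `α n β'` with `α` a permutation of `[a]` and `β' = β + a`, so `π = α ⊕ (1 ⊖ β)`; then
`P(π) = (P(α) ⊕ 1) ⊖ P(β)`. -/
def bijP (π : List ℕ) : List ℕ :=
  if _h : π = [] then []
  else ominus (oplus (bijP (beforeMax π)) [1])
    (bijP ((afterMax π).map (· - (beforeMax π).length)))
termination_by π.length
decreasing_by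
  · exact length_beforeMax_lt _h
  · simpa using length_afterMax_lt _h

theorem length_bijP (π : List ℕ) : (bijP π).length = π.length := by
  induction h : π.length using Nat.strong_induction_on generalizing π with
  | _ n ih =>
    subst h
    rw [bijP]
    split_ifs with h0
    · simp [h0]
    · have h1 := ih _ (length_beforeMax_lt h0) _ rfl
      have h2 := ih ((afterMax π).map (· - (beforeMax π).length)).length
        (by simpa using length_afterMax_lt h0) _ rfl
      have h3 := congrArg List.length (beforeMax_append_afterMax h0)
      simp only [List.length_append, List.length_cons] at h3
      simp only [ominus, oplus, List.length_append, List.length_map, List.length_cons,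
        List.length_nil, h1, h2]
      omega

/-- The relabeling `λ_π`, which sends the value at position `i` of `π` to the value at position `i`
of `P(π)` (and fixes the numbers that are not values of `π`). -/
def relabel (π : List ℕ) (v : ℕ) : ℕ := (bijP π).getD (π.idxOf v) v

/-- The defining property `P(π) = λ_π ∘ π`. -/
theorem map_relabel {π : List ℕ} (hπ : π.Nodup) : π.map (relabel π) = bijP π := by
  apply List.ext_getElem
  · simp [length_bijP]
  · intro i h1 h2
    have h3 : i < π.length := by simpa using h1
    simp [relabel, hπ.idxOf_getElem i h3, h2]

/-- The two operators, as letters: `S` is stack sorting and `R` is reversal. -/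
inductive Op
  | S
  | R

/-- The operator on words that a letter stands for. -/
def Op.toFun : Op → List ℕ → List ℕ
  | Op.S => stackSort
  | Op.R => List.reverse

/-- The operator `X₁ ∘ X₂ ∘ ⋯ ∘ X_m` given by the formal composition `[X₁, X₂, …, X_m]`
(`X_m` acts first; the empty composition is the identity). -/
def compose : List Op → List ℕ → List ℕ
  | [] => id
  | X :: W => X.toFun ∘ compose W

/-- The reduced form of a formal composition: all factors `R ∘ R = id` are cancelled, until no
two consecutive letters `R` remain. -/
def reduce : List Op → List Op
  | [] => []
  | Op.S :: W => Op.S :: reduce W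
  | Op.R :: W =>
    match reduce W with
    | Op.R :: V => V
    | V => Op.R :: V

theorem compose_reduce (W : List Op) : compose (reduce W) = compose W := by
  induction W with
  | nil => rfl
  | cons X W ih =>
    cases X with
    | S => simp [reduce, compose, ih]
    | R =>
      simp only [reduce, compose]
      rw [← ih]
      split
      · rename_i V hV
        rw [hV]
        funext w
        simp [compose, Op.toFun]
      · rfl

/-- The word `θ`, of length `n`, is sorted by the operator `B`: `B(θ) = 1 2 … n`. -/
def SortedBy (B : List ℕ → List ℕ) (θ : List ℕ) : Prop := B θ = List.range' 1 θ.length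

/-- The map `Φ_A`, `Φ_A(θ) = λ_{A(θ)} ∘ θ`, for `θ` sorted by `S ∘ A`. -/
def Phi (A : List ℕ → List ℕ) (θ : List ℕ) : List ℕ := θ.map (relabel (A θ))

/-- The word `(n-k+1) … (n-1) n` with `k` letters, for `k ≤ n`. -/
def topRun (n k : ℕ) : List ℕ := List.range' (n + 1 - k) k

/-- `zeil(π)`, for a permutation `π` of `[n]`: the largest `k ≤ n` such that
`n (n-1) … (n-k+1)` is a subword of `π`. -/
def zeil (π : List ℕ) : ℕ :=
  Nat.findGreatest (fun k => List.Sublist (topRun π.length k).reverse π) π.length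

/-- `Rzeil(π)`, for a permutation `π` of `[n]`: the largest `k ≤ n` such that
`(n-k+1) … (n-1) n` is a subword of `π`. -/
def rzeil (π : List ℕ) : ℕ :=
  Nat.findGreatest (fun k => List.Sublist (topRun π.length k) π) π.length

end StackSort

namespace StackSort

open List

/-! Let `π = A(θ)` and `λ = λ_π`. Stack sorting depends only on comparisons of an entry with the
maximum of a factor containing it, that is, on the decreasing binary tree. Tree relations of a word
persist under `S` and `R` (`Descends.compose`), and `λ` respects the tree of `π`
(`Avoids231.respects`). So `λ` respects the trees of all intermediate words and commutes with `A`,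
whence `A(Φ(θ)) = P(π)` (`compose_Phi`).

Let `t = (n-k+1) ⋯ n`. If the reversal of `t` is a subword of `w`, then `S(w)` ends in `t`. From
then on `S` and `R` keep `t` as a suffix or its reversal as a prefix (`HasTopEnd`). If instead `t`
is a subword, `S` keeps it so, and a later `S ∘ R` produces a top end. Finally `P` preserves and
reflects top ends, so `λ` fixes every letter of `t` (`Avoids231.map_topRun`). Hence `t`, or its
reversal, is a subword of `θ` exactly when it is one of `λ ∘ θ`. -/

theorem le_maxEntry {w : List ℕ} {x : ℕ} (hx : x ∈ w) : x ≤ maxEntry w := by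
  induction w with
  | nil => simp at hx
  | cons a l ih =>
    change x ≤ max a (maxEntry l)
    rcases mem_cons.1 hx with rfl | h
    · exact le_max_left _ _
    · exact (ih h).trans (le_max_right _ _)

/-! ### Splitting a word at its maximum. -/

section Split

variable {α β : List ℕ} {m : ℕ}

theorem maxEntry_split (hα : ∀ x ∈ α, x < m) (hβ : ∀ x ∈ β, x < m) :
    maxEntry (α ++ m :: β) = m := by
  apply le_antisymm
  · have h := maxEntry_mem (w := α ++ m :: β) (by simp)
    simp only [mem_append, mem_cons] at h
    rcases h with h | h | h
    · exact (hα _ h).le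
    · exact h.le
    · exact (hβ _ h).le
  · exact le_maxEntry (by simp)

theorem idxOf_maxEntry_split (hα : ∀ x ∈ α, x < m) (hβ : ∀ x ∈ β, x < m) :
    (α ++ m :: β).idxOf (maxEntry (α ++ m :: β)) = α.length := by
  rw [maxEntry_split hα hβ, idxOf_append_of_notMem fun h => (hα m h).false]
  simp

theorem beforeMax_split (hα : ∀ x ∈ α, x < m) (hβ : ∀ x ∈ β, x < m) :
    beforeMax (α ++ m :: β) = α := by
  rw [beforeMax, idxOf_maxEntry_split hα hβ, take_left]

theorem afterMax_split (hα : ∀ x ∈ α, x < m) (hβ : ∀ x ∈ β, x < m) :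
    afterMax (α ++ m :: β) = β := by
  rw [afterMax, idxOf_maxEntry_split hα hβ]
  simp

theorem stackSort_split (hα : ∀ x ∈ α, x < m) (hβ : ∀ x ∈ β, x < m) :
    stackSort (α ++ m :: β) = stackSort α ++ stackSort β ++ [m] := by
  rw [stackSort, dif_neg (by simp), beforeMax_split hα hβ, afterMax_split hα hβ,
    maxEntry_split hα hβ]

end Split

@[simp] theorem stackSort_nil : stackSort [] = [] := by rw [stackSort, dif_pos rfl]

@[simp] theorem bijP_nil : bijP [] = [] := by rw [bijP, dif_pos rfl]

theorem maxSplit_induction {p : ∀ w : List ℕ, w.Nodup → Prop} (nil : p [] nodup_nil)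
    (split : ∀ α m β (h : (α ++ m :: β).Nodup) (h₁ : α.Nodup) (h₂ : β.Nodup),
      (∀ x ∈ α, x < m) → (∀ x ∈ β, x < m) → p α h₁ → p β h₂ → p (α ++ m :: β) h)
    (w : List ℕ) (hw : w.Nodup) : p w hw := by
  induction h : w.length using Nat.strong_induction_on generalizing w with
  | _ n ih =>
    subst h
    rcases eq_or_ne w [] with rfl | h0
    · exact nil
    have e := beforeMax_append_afterMax h0
    have hw' := hw
    rw [← e, nodup_append, nodup_cons] at hw'
    obtain ⟨h1, ⟨h2, h3⟩, h4⟩ := hw'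
    have key := split (beforeMax w) (maxEntry w) (afterMax w) (by rwa [e]) h1 h3
      (fun x hx => lt_of_le_of_ne (le_maxEntry (by rw [← e]; simp [hx]))
        (h4 x hx _ (by simp)))
      (fun x hx => lt_of_le_of_ne (le_maxEntry (by rw [← e]; simp [hx]))
        (fun h => h2 (h ▸ hx)))
      (ih _ (length_beforeMax_lt h0) _ h1 rfl) (ih _ (length_afterMax_lt h0) _ h3 rfl)
    simpa only [e] using key

theorem stackSort_perm {w : List ℕ} (hw : w.Nodup) : (stackSort w).Perm w := by
  induction w, hw using maxSplit_induction with
  | nil => simp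
  | split α m β _ _ _ hα hβ ihα ihβ =>
    rw [stackSort_split hα hβ, append_assoc]
    exact ihα.append ((perm_append_singleton _ _).trans (ihβ.cons m))

/-! ### Decreasing binary trees and relabelings that respect them. -/

/-- The entry `b` is the largest one of a factor of `w` that contains `a` and `b`, i.e. `a` is a
descendant of `b` in the decreasing binary tree of `w`. -/
def Descends (w : List ℕ) (a b : ℕ) : Prop :=
  ∃ u, u <:+: w ∧ a ∈ u ∧ b ∈ u ∧ ∀ x ∈ u, x ≤ b

theorem Descends.mono {v w : List ℕ} {a b : ℕ} (hvw : v <:+: w) (h : Descends v a b) :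
    Descends w a b :=
  let ⟨u, hu, h⟩ := h
  ⟨u, hu.trans hvw, h⟩

theorem Descends.reverse {w : List ℕ} {a b : ℕ} (h : Descends w a b) :
    Descends w.reverse a b := by
  obtain ⟨u, hu, ha, hb, hx⟩ := h
  exact ⟨u.reverse, reverse_infix.2 hu, by simpa, by simpa, by simpa⟩

theorem infix_split {u α β : List ℕ} {m : ℕ} (h : u <:+: α ++ m :: β) :
    u <:+: α ∨ m ∈ u ∨ u <:+: β := by
  rcases infix_append_iff.1 h with h | h | ⟨l₁, l₂, rfl, h₁, h₂⟩
  · exact .inl h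
  · rcases infix_cons_iff.1 h with h | h
    · rcases prefix_cons_iff.1 h with rfl | ⟨t, rfl, -⟩
      · exact .inl (nil_infix)
      · simp
    · exact .inr (.inr h)
  · rcases prefix_cons_iff.1 h₂ with rfl | ⟨t, rfl, -⟩
    · exact .inl (by simpa using h₁.isInfix)
    · simp

/-- A factor containing the maximum `m` forces `b = m`, and then all of `S(w)` is a witness. Any
other factor lies in `α` or `β`, and `S(α)`, `S(β)` are factors of `S(w)`. -/
theorem Descends.stackSort {w : List ℕ} (hw : w.Nodup) {a b : ℕ} (h : Descends w a b) :
    Descends (stackSort w) a b := by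
  induction w, hw using maxSplit_induction with
  | nil => simpa using h
  | split α m β hn _ _ hα hβ ihα ihβ =>
    rw [stackSort_split hα hβ]
    obtain ⟨u, hu, ha, hb, hx⟩ := h
    rcases infix_split hu with h | h | h
    · exact (ihα ⟨u, h, ha, hb, hx⟩).mono (by rw [append_assoc]; exact (prefix_append _ _).isInfix)
    · have hmem : ∀ x ∈ α ++ m :: β, x ≤ m := by
        intro x hx
        simp only [mem_append, mem_cons] at hx
        rcases hx with h | h | h
        · exact (hα x h).le
        · exact h.le
        · exact (hβ x h).le
      obtain rfl : b = m := le_antisymm (hmem b (hu.subset hb)) (hx m h)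
      rw [← stackSort_split hα hβ]
      have hp := stackSort_perm hn
      exact ⟨_, infix_rfl, hp.mem_iff.2 (hu.subset ha), hp.mem_iff.2 (by simp),
        fun x hx => hmem x (hp.mem_iff.1 hx)⟩
    · exact (ihβ ⟨u, h, ha, hb, hx⟩).mono (infix_append _ _ _)

/-- The relabeling `f` is injective on the entries of `w` and respects the decreasing binary tree
of `w`. -/
structure Respects (f : ℕ → ℕ) (w : List ℕ) : Prop where
  injOn : ∀ a ∈ w, ∀ b ∈ w, f a = f b → a = b
  le : ∀ a b, Descends w a b → f a ≤ f b

theorem Respects.mono {f : ℕ → ℕ} {v w : List ℕ} (hvw : v <:+: w) (h : Respects f w) :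
    Respects f v :=
  ⟨fun a ha b hb => h.injOn a (hvw.subset ha) b (hvw.subset hb), fun a b hab => h.le a b (hab.mono hvw)⟩

theorem Respects.stackSort_map {f : ℕ → ℕ} {w : List ℕ} (hw : w.Nodup) (h : Respects f w) :
    stackSort (w.map f) = (stackSort w).map f := by
  induction w, hw using maxSplit_induction with
  | nil => simp
  | split α m β hn _ _ hα hβ ihα ihβ =>
    have key : ∀ x ∈ α ++ m :: β, x < m → f x < f m := fun x hx hxm =>
      lt_of_le_of_ne (h.le x m ⟨_, infix_rfl, hx, by simp, fun y hy => by
        simp only [mem_append, mem_cons] at hy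
        rcases hy with h | h | h
        · exact (hα y h).le
        · exact h.le
        · exact (hβ y h).le⟩) fun e => hxm.ne (h.injOn x hx m (by simp) e)
    have hα' : ∀ x ∈ α.map f, x < f m := by
      simp only [mem_map, forall_exists_index, and_imp, forall_apply_eq_imp_iff₂]
      exact fun x hx => key x (by simp [hx]) (hα x hx)
    have hβ' : ∀ x ∈ β.map f, x < f m := by
      simp only [mem_map, forall_exists_index, and_imp, forall_apply_eq_imp_iff₂]
      exact fun x hx => key x (by simp [hx]) (hβ x hx)
    rw [map_append, map_cons, stackSort_split hα' hβ', stackSort_split hα hβ,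
      ihα (h.mono (prefix_append _ _).isInfix),
      ihβ (h.mono (((suffix_cons m β).trans (suffix_append _ _)).isInfix))]
    simp

theorem compose_perm (W : List Op) {w : List ℕ} (hw : w.Nodup) : (compose W w).Perm w := by
  induction W with
  | nil => rfl
  | cons X W ih =>
    cases X with
    | S => exact (stackSort_perm (ih.nodup_iff.2 hw)).trans ih
    | R => exact (reverse_perm _).trans ih

theorem Descends.compose (W : List Op) {w : List ℕ} (hw : w.Nodup) {a b : ℕ}
    (h : Descends w a b) : Descends (compose W w) a b := by
  induction W with
  | nil => exact h
  | cons X W ih =>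
    cases X with
    | S => exact ih.stackSort ((compose_perm W hw).nodup_iff.2 hw)
    | R => exact ih.reverse

theorem Respects.of_compose (W : List Op) {f : ℕ → ℕ} {w : List ℕ} (hw : w.Nodup)
    (h : Respects f (compose W w)) : Respects f w :=
  have hp := compose_perm W hw
  ⟨fun a ha b hb => h.injOn a (hp.mem_iff.2 ha) b (hp.mem_iff.2 hb),
    fun a b hab => h.le a b (hab.compose W hw)⟩

/-- A relabeling that respects the decreasing binary tree of the last word respects those of all
earlier words, and so commutes with the whole composition. -/
theorem Respects.compose_map (W : List Op) {f : ℕ → ℕ} {w : List ℕ} (hw : w.Nodup)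
    (h : Respects f (compose W w)) : compose W (w.map f) = (compose W w).map f := by
  induction W with
  | nil => rfl
  | cons X W ih =>
    have hn := (compose_perm W hw).nodup_iff.2 hw
    cases X with
    | S =>
      have h' : Respects f (compose W w) := of_compose [Op.S] hn h
      change stackSort (compose W (w.map f)) = (stackSort (compose W w)).map f
      rw [ih h', h'.stackSort_map hn]
    | R =>
      have h' : Respects f (compose W w) := of_compose [Op.R] hn h
      change (compose W (w.map f)).reverse = (compose W w).reverse.map f
      rw [ih h', map_reverse]

/-! ### Top runs under `S` and `R`. -/

/-- The word `t` is increasing and its letters exceed all other entries of `w`. -/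
structure IsTop (t w : List ℕ) : Prop where
  nodup : w.Nodup
  pairwise : t.Pairwise (· < ·)
  lt : ∀ x ∈ w, x ∉ t → ∀ y ∈ t, x < y

theorem IsTop.of_perm {t v w : List ℕ} (h : IsTop t w) (hp : v.Perm w) : IsTop t v :=
  ⟨hp.nodup_iff.2 h.nodup, h.pairwise, fun x hx => h.lt x (hp.mem_iff.1 hx)⟩

/-- `IsTop` does not require the letters of `t` to occur in `w`, so it passes to both sides of the
maximum; this drives the inductions below. -/
theorem IsTop.concat {t w : List ℕ} {m : ℕ} (h : IsTop (t ++ [m]) w) (hm : m ∈ w) :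
    ∃ α β, w = α ++ m :: β ∧ m ∉ α ∧ m ∉ β ∧ (∀ x ∈ α, x < m) ∧ (∀ x ∈ β, x < m) ∧
      IsTop t α ∧ IsTop t β := by
  obtain ⟨α, β, rfl⟩ := append_of_mem hm
  have hn := h.nodup
  rw [nodup_append, nodup_cons] at hn
  obtain ⟨h1, ⟨h2, h3⟩, h4⟩ := hn
  have hmα : m ∉ α := fun hm => h4 m hm m (by simp) rfl
  have hp := pairwise_append.1 h.pairwise
  have hlt : ∀ x ∈ α ++ m :: β, x ≠ m → x < m := fun x hx hxm => by
    by_cases hxt : x ∈ t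
    · exact hp.2.2 x hxt m (by simp)
    · exact h.lt x hx (by simp [hxt, hxm]) m (by simp)
  have hα : ∀ x ∈ α, x ≠ m := fun x hx e => hmα (e ▸ hx)
  have hβ : ∀ x ∈ β, x ≠ m := fun x hx e => h2 (e ▸ hx)
  exact ⟨α, β, rfl, hmα, h2, fun x hx => hlt x (by simp [hx]) (hα x hx),
    fun x hx => hlt x (by simp [hx]) (hβ x hx),
    ⟨h1, hp.1, fun x hx hxt y hy =>
      h.lt x (by simp [hx]) (by simp [hxt, hα x hx]) y (by simp [hy])⟩,
    ⟨h3, hp.1, fun x hx hxt y hy =>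
      h.lt x (by simp [hx]) (by simp [hxt, hβ x hx]) y (by simp [hy])⟩⟩

/-- The maximum comes first in the reversed run, so the other letters lie in `β`, and `S(β) m` is a
suffix of `S(w)`. -/
theorem IsTop.suffix_stackSort_of_reverse_sublist {t w : List ℕ} (h : IsTop t w)
    (ht : t.reverse <+ w) : t <:+ stackSort w := by
  induction t using reverseRecOn generalizing w with
  | nil => exact nil_suffix
  | append_singleton t m ih =>
    rw [reverse_append, reverse_singleton, singleton_append] at ht
    obtain ⟨α, β, rfl, hmα, hmβ, hα, hβ, -, hβ'⟩ := h.concat (ht.subset (by simp))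
    rw [stackSort_split hα hβ]
    refine (suffix_append_inj_of_length_eq rfl).2 ⟨(ih hβ' ?_).trans (suffix_append _ _), rfl⟩
    obtain ⟨l₁, l₂, e, h₁, h₂⟩ := sublist_append_iff.1 ht
    rcases l₁ with _ | ⟨c, l₁⟩
    · rw [nil_append] at e
      subst e
      exact cons_sublist_cons.1 h₂
    · obtain ⟨rfl, -⟩ := cons_eq_cons.1 e
      exact absurd (h₁.subset (by simp)) hmα

theorem IsTop.suffix_stackSort_of_suffix {t w : List ℕ} (h : IsTop t w)
    (ht : t <:+ w) : t <:+ stackSort w := by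
  induction t using reverseRecOn generalizing w with
  | nil => exact nil_suffix
  | append_singleton t m ih =>
    obtain ⟨α, β, rfl, hmα, hmβ, hα, hβ, hα', -⟩ := h.concat (ht.subset (by simp))
    rw [stackSort_split hα hβ]
    rcases eq_nil_or_concat β with rfl | ⟨β, c, rfl⟩
    · rw [suffix_append_inj_of_length_eq rfl] at ht
      simpa [suffix_append_inj_of_length_eq] using ih hα' ht.1
    · rw [concat_eq_append, ← cons_append, ← append_assoc] at ht
      have e := ((suffix_append_inj_of_length_eq (s₁ := [m]) (s₂ := [c]) rfl).1 ht).2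
      exact absurd (by simp_all) hmβ

/-- Here the maximum comes last, so the other letters of the run lie in `α`. -/
theorem IsTop.sublist_stackSort {t w : List ℕ} (h : IsTop t w) (ht : t <+ w) :
    t <+ stackSort w := by
  induction t using reverseRecOn generalizing w with
  | nil => exact nil_sublist _
  | append_singleton t m ih =>
    obtain ⟨α, β, rfl, hmα, hmβ, hα, hβ, hα', -⟩ := h.concat (ht.subset (by simp))
    rw [stackSort_split hα hβ]
    refine Sublist.append ((ih hα' ?_).trans (sublist_append_left _ _)) (Sublist.refl _)
    obtain ⟨l₁, l₂, e, h₁, h₂⟩ := sublist_append_iff.1 ht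
    rcases eq_nil_or_concat l₂ with rfl | ⟨l₂, c, rfl⟩
    · rw [append_nil] at e
      subst e
      exact absurd (h₁.subset (by simp)) hmα
    · rw [concat_eq_append] at h₂ e
      rw [← append_assoc] at e
      obtain ⟨rfl, e⟩ := append_inj' e rfl
      obtain rfl : m = c := by simpa using e
      rcases l₂ with _ | ⟨d, l₂⟩
      · simpa using h₁
      · rcases cons_sublist_cons'.1 h₂ with h | ⟨rfl, h⟩
        · exact absurd (h.subset (by simp)) hmβ
        · exact absurd (h.subset (by simp)) hmβ


/-- The word `w` has the increasing word `t` as a suffix or its reversal as a prefix. -/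
def HasTopEnd (t w : List ℕ) : Prop := t <:+ w ∨ t.reverse <+: w

theorem HasTopEnd.stackSort {t w : List ℕ} (h : IsTop t w) (ht : HasTopEnd t w) :
    HasTopEnd t (stackSort w) :=
  .inl <| ht.elim h.suffix_stackSort_of_suffix
    fun h' => h.suffix_stackSort_of_reverse_sublist h'.sublist

theorem HasTopEnd.reverse {t w : List ℕ} (ht : HasTopEnd t w) : HasTopEnd t w.reverse :=
  ht.symm.imp (fun h => by simpa using reverse_suffix.2 h) reverse_prefix.2

theorem HasTopEnd.compose (W : List Op) {t w : List ℕ} (h : IsTop t w) (ht : HasTopEnd t w) :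
    HasTopEnd t (compose W w) := by
  induction W with
  | nil => exact ht
  | cons X W ih =>
    cases X with
    | S => exact ih.stackSort (h.of_perm (compose_perm W h.nodup))
    | R => exact ih.reverse

/-- No two consecutive letters are both `R`. -/
def IsReduced (W : List Op) : Prop := W.IsChain fun X Y => ¬(X = Op.R ∧ Y = Op.R)

theorem isReduced_reduce (W : List Op) : IsReduced (reduce W) := by
  induction W with
  | nil => exact .nil
  | cons X W ih =>
    cases X with
    | S =>
      rw [reduce]
      exact isChain_cons.2 ⟨by simp, ih⟩
    | R =>
      rw [reduce]
      split
      · rename_i V hV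
        rw [hV] at ih
        exact (isChain_cons.1 ih).2
      · rename_i V hV
        refine isChain_cons.2 ⟨?_, ih⟩
        rintro Y hY ⟨-, rfl⟩
        obtain ⟨U, hU⟩ := head?_eq_some_iff.1 hY
        exact hV U hU

/-- The invariant while no `S ∘ R` has occurred: the run is a subword, reversed exactly when the
latest operator is `R`. In a reduced composition the operator after such an `R` is `S`, which
creates a top end. -/
theorem hasTopEnd_compose_or {W : List Op} (hW : IsReduced W) {t w : List ℕ} (h : IsTop t w)
    (ht : t <+ w) :
    HasTopEnd t (compose W w) ∨ ¬[Op.S, Op.R] <:+: W ∧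
      (t <+ compose W w ∧ W.head? ≠ some Op.R ∨
        t.reverse <+ compose W w ∧ W.head? = some Op.R) := by
  induction W with
  | nil => exact .inr ⟨by simp, .inl ⟨ht, by simp⟩⟩
  | cons X W ih =>
    obtain ⟨hX, hW'⟩ := isChain_cons.1 hW
    have hw : IsTop t (compose W w) := h.of_perm (compose_perm W h.nodup)
    cases X with
    | S =>
      rcases ih hW' with h' | ⟨hSR, ⟨h', hR⟩ | ⟨h', -⟩⟩
      · exact .inl (h'.stackSort hw)
      · refine .inr ⟨fun hi => ?_, .inl ⟨hw.sublist_stackSort h', by simp⟩⟩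
        rcases infix_cons_iff.1 hi with hp | hi
        · obtain ⟨U, hU⟩ := (cons_prefix_cons.1 hp).2
          exact hR (by simp [← hU])
        · exact hSR hi
      · exact .inl (.inl (hw.suffix_stackSort_of_reverse_sublist h'))
    | R =>
      rcases ih hW' with h' | ⟨hSR, ⟨h', hR⟩ | ⟨-, hR⟩⟩
      · exact .inl h'.reverse
      · refine .inr ⟨fun hi => ?_, .inr ⟨reverse_sublist.2 h', rfl⟩⟩
        rcases infix_cons_iff.1 hi with hp | hi
        · exact absurd (cons_prefix_cons.1 hp).1 (by simp)
        · exact hSR hi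
      · exact absurd ⟨rfl, rfl⟩ (hX _ hR)

theorem hasTopEnd_compose_of_sublist {W : List Op} (hW : [Op.S, Op.R] <:+: reduce W)
    {t w : List ℕ} (h : IsTop t w) (ht : t <+ w) : HasTopEnd t (compose W w) := by
  rw [← compose_reduce]
  exact (hasTopEnd_compose_or (isReduced_reduce W) h ht).resolve_right fun h' => h'.1 hW

/-! ### `231`-avoiding permutations and the map `P`. -/

/-- The permutations built from smaller ones as `α ⊕ (1 ⊖ β)`, i.e. those avoiding `231`. -/
inductive Avoids231 : List ℕ → Prop
  | nil : Avoids231 []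
  | node {α β : List ℕ} : Avoids231 α → Avoids231 β →
      Avoids231 (α ++ (α.length + β.length + 1) :: β.map (· + α.length))

theorem IsPerm.length_eq {n : ℕ} {π : List ℕ} (h : IsPerm n π) : π.length = n := by
  simpa using Perm.length_eq h

theorem IsPerm.nodup {n : ℕ} {π : List ℕ} (h : IsPerm n π) : π.Nodup :=
  (Perm.nodup_iff h).2 (nodup_range' ..)

theorem IsPerm.le {n : ℕ} {π : List ℕ} (h : IsPerm n π) {x : ℕ} (hx : x ∈ π) : x ≤ n := by
  have := (Perm.mem_iff h).1 hx
  rw [mem_range'_1] at this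
  omega

theorem isPerm_zero : IsPerm 0 [] := Perm.refl _

theorem isPerm_oplus {a b : ℕ} {α β : List ℕ} (hα : IsPerm a α) (hβ : IsPerm b β) :
    IsPerm (a + b) (oplus α β) := by
  have h := Perm.append hα (Perm.map (· + a) hβ)
  rw [IsPerm, oplus, hα.length_eq]
  convert h using 1
  rw [show (fun x => x + a) = (a + ·) from funext fun x => add_comm x a, map_add_range',
    add_comm a 1, ← range'_append_1, add_comm 1 a]

theorem isPerm_ominus {a b : ℕ} {α β : List ℕ} (hα : IsPerm a α) (hβ : IsPerm b β) :
    IsPerm (a + b) (ominus α β) := by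
  rw [add_comm]
  have h := isPerm_oplus hβ hα
  rw [IsPerm, oplus, hβ.length_eq] at h
  rw [IsPerm, ominus, hβ.length_eq]
  exact perm_append_comm.trans h

theorem isPerm_one : IsPerm 1 [1] := Perm.refl _

theorem Avoids231.isPerm {π : List ℕ} (h : Avoids231 π) : IsPerm π.length π := by
  induction h with
  | nil => exact isPerm_zero
  | @node α β _ _ ihα ihβ =>
    have h := isPerm_oplus ihα (isPerm_ominus isPerm_one ihβ)
    convert h using 1
    · simp; omega
    · simp [oplus, ominus]
      omega

section Node

variable {α β : List ℕ}

theorem Avoids231.lt_left (hα : Avoids231 α) : ∀ x ∈ α, x < α.length + β.length + 1 :=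
  fun x hx => by have := hα.isPerm.le hx; omega

theorem Avoids231.lt_right (hβ : Avoids231 β) :
    ∀ x ∈ β.map (· + α.length), x < α.length + β.length + 1 := by
  simp only [mem_map, forall_exists_index, and_imp, forall_apply_eq_imp_iff₂]
  exact fun x hx => by have := hβ.isPerm.le hx; omega

theorem bijP_node (hα : Avoids231 α) (hβ : Avoids231 β) :
    bijP (α ++ (α.length + β.length + 1) :: β.map (· + α.length)) =
      (bijP α).map (· + β.length) ++ (α.length + β.length + 1) :: bijP β := by
  rw [bijP, dif_neg (by simp), beforeMax_split hα.lt_left hβ.lt_right,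
    afterMax_split hα.lt_left hβ.lt_right, map_map]
  have : ((fun x => x - α.length) ∘ fun x => x + α.length) = id := by ext; simp
  rw [this, map_id, ominus, oplus, length_bijP, length_bijP]
  simp only [map_append, map_cons, map_nil, append_assoc, singleton_append]
  congr 2
  omega

end Node

theorem Avoids231.isPerm_bijP {π : List ℕ} (h : Avoids231 π) : IsPerm π.length (bijP π) := by
  induction h with
  | nil => simpa using isPerm_zero
  | @node α β hα hβ ihα ihβ =>
    have h := isPerm_ominus (isPerm_oplus ihα isPerm_one) ihβ
    rw [bijP_node hα hβ]
    convert h using 1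
    · simp; omega
    · simp [oplus, ominus, length_bijP]
      omega

theorem stackSort_map_add {w : List ℕ} (hw : w.Nodup) (a : ℕ) :
    stackSort (w.map (· + a)) = (stackSort w).map (· + a) :=
  Respects.stackSort_map hw ⟨fun x _ y _ h => by simpa using h, fun x y ⟨u, _, hx, _, h⟩ => by
    simpa using h x hx⟩

/-- Comparing `S(α) S(β) m` with the identity shows that `α` carries the smallest values and `β` the
next ones, each again sorted by `S` up to a shift. -/
theorem avoids231_of_stackSort {π : List ℕ} (hn : π.Nodup)
    (h : stackSort π = range' 1 π.length) : Avoids231 π := by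
  induction hl : π.length using Nat.strong_induction_on generalizing π with
  | _ n ih =>
    subst hl
    induction π, hn using maxSplit_induction with
    | nil => exact .nil
    | split α m β hn hnα hnβ hα hβ =>
      have hlen : (α ++ m :: β).length = α.length + β.length + 1 := by simp; omega
      rw [stackSort_split hα hβ, hlen, range'_concat, ← range'_append_1] at h
      obtain ⟨h, hm⟩ := append_inj' h rfl
      obtain ⟨h1, h2⟩ := append_inj h (by simp [(stackSort_perm hnα).length_eq])
      obtain rfl : m = α.length + β.length + 1 := by simpa [add_comm] using hm
      have hα' := ih α.length (by simp) hnα h1 rfl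
      have hge : ∀ x ∈ β, α.length ≤ x := fun x hx => by
        have := (stackSort_perm hnβ).mem_iff.2 hx
        rw [h2, mem_range'_1] at this
        omega
      obtain ⟨γ, rfl⟩ : ∃ γ : List ℕ, γ.map (· + α.length) = β :=
        ⟨β.map (· - α.length), by
          rw [map_map]
          exact (map_congr_left fun x hx => Nat.sub_add_cancel (hge x hx)).trans (map_id _)⟩
      have hnγ := hnβ.of_map
      rw [length_map] at *
      refine .node hα' (ih γ.length (by simp; omega) hnγ ?_ rfl)
      rw [stackSort_map_add hnγ, add_comm 1, ← map_add_range'] at h2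
      apply map_injective_iff.2 (add_left_injective α.length)
      simpa [add_comm] using h2

/-- `P` keeps the maximum in place and acts on `α` and `β` separately up to shifts. Allowing any `f`
with `hf` lets the induction use shifted relabelings. -/
theorem Avoids231.respects {π : List ℕ} (h : Avoids231 π) {f : ℕ → ℕ} (hf : π.map f = bijP π) :
    Respects f π := by
  refine ⟨fun a ha b hb => inj_on_of_nodup_map (hf ▸ h.isPerm_bijP.nodup) ha hb, ?_⟩
  induction h generalizing f with
  | nil =>
    rintro a b ⟨u, hu, ha, -⟩
    simpa using hu.subset ha
  | @node α β hα hβ ihα ihβ =>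
    have hle : ∀ x ∈ α ++ (α.length + β.length + 1) :: β.map (· + α.length),
        f x ≤ α.length + β.length + 1 := fun x hx => by
      have := (Avoids231.node hα hβ).isPerm_bijP.le (hf ▸ mem_map_of_mem hx)
      simp only [length_append, length_cons, length_map] at this
      omega
    rw [bijP_node hα hβ, map_append, map_cons] at hf
    obtain ⟨hfα, hfβ⟩ := append_inj hf (by simp [length_bijP])
    obtain ⟨hfm, hfβ⟩ := cons_eq_cons.1 hfβ
    rintro a b ⟨u, hu, ha, hb, hx⟩
    rcases infix_split hu with h | h | h
    · have key := ihα (f := fun x => f x - β.length) (by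
        have := congrArg (map (· - β.length)) hfα
        rw [map_map, map_map] at this
        exact this.trans ((map_congr_left fun x _ => Nat.add_sub_cancel ..).trans (map_id _)))
        a b ⟨u, h, ha, hb, hx⟩
      -- The subtraction above truncates; this bound lets the inequality be lifted back to `f`.
      have hge : ∀ x ∈ α, β.length ≤ f x := fun x hx => by
        obtain ⟨y, -, hy⟩ := mem_map.1 (hfα ▸ mem_map_of_mem (f := f) hx)
        omega
      have := hge a (h.subset ha)
      have := hge b (h.subset hb)
      omega
    · have hbm : b = α.length + β.length + 1 := by
        refine le_antisymm ?_ (hx _ h)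
        have := (Avoids231.node hα hβ).isPerm.le (hu.subset hb)
        simp only [length_append, length_cons, length_map] at this
        omega
      rw [hbm, hfm]
      exact hle a (hu.subset ha)
    · obtain ⟨v, hv, rfl⟩ := infix_map_iff.1 h
      obtain ⟨a, ha', rfl⟩ := mem_map.1 ha
      obtain ⟨b, hb', rfl⟩ := mem_map.1 hb
      exact ihβ (f := fun x => f (x + α.length)) (by rw [← hfβ, map_map]; rfl) a b
        ⟨v, hv, ha', hb', fun x hxv => by simpa using hx _ (mem_map_of_mem hxv)⟩

theorem topRun_succ {n k : ℕ} (h : k ≤ n) : topRun (n + 1) (k + 1) = topRun n k ++ [n + 1] := by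
  rw [topRun, topRun, range'_concat]
  congr 2 <;> grind

/-- In both words a nonempty run can be a suffix only if `β` is empty; then the question reduces to
`α`. For prefixes, `α` must be empty instead. -/
theorem Avoids231.topRun_suffix_iff {π : List ℕ} (h : Avoids231 π) {k : ℕ} (hk : k ≤ π.length) :
    topRun π.length k <:+ bijP π ↔ topRun π.length k <:+ π := by
  induction h generalizing k with
  | nil => simp
  | @node α β hα hβ ihα ihβ =>
    have hlen : (α ++ (α.length + β.length + 1) :: β.map (· + α.length)).length =
        α.length + β.length + 1 := by simp; omega
    rw [hlen] at hk ⊢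
    rw [bijP_node hα hβ]
    rcases k with _ | k
    · simp [topRun]
    rw [topRun_succ (by omega)]
    rcases eq_or_ne β [] with rfl | h0
    · have := ihα (k := k) (by simpa using hk)
      simpa [suffix_append_inj_of_length_eq] using this
    · have aux : ∀ (u v t : List ℕ) (m : ℕ), v ≠ [] → (∀ x ∈ v, x < m) → ¬ t ++ [m] <:+ u ++ m :: v := by
        intro u v t m hv hlt hs
        obtain ⟨v, c, rfl⟩ := (eq_nil_or_concat v).resolve_left hv
        rw [concat_eq_append, ← cons_append, ← append_assoc] at hs
        have e := ((suffix_append_inj_of_length_eq (s₁ := [m]) (s₂ := [c]) rfl).1 hs).2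
        have := hlt c (by simp)
        simp at e
        omega
      exact iff_of_false
        (aux _ _ _ _ (by simpa [← length_eq_zero_iff, length_bijP] using h0)
          fun x hx => by have := hβ.isPerm_bijP.le hx; omega)
        (aux _ _ _ _ (by simpa using h0) hβ.lt_right)

theorem Avoids231.topRun_prefix_iff {π : List ℕ} (h : Avoids231 π) {k : ℕ} (hk : k ≤ π.length) :
    (topRun π.length k).reverse <+: bijP π ↔ (topRun π.length k).reverse <+: π := by
  induction h generalizing k with
  | nil => simp
  | @node α β hα hβ ihα ihβ =>
    have hlen : (α ++ (α.length + β.length + 1) :: β.map (· + α.length)).length =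
        α.length + β.length + 1 := by simp; omega
    rw [hlen] at hk ⊢
    rw [bijP_node hα hβ]
    rcases k with _ | k
    · simp [topRun]
    rw [topRun_succ (by omega)]
    rcases α with _ | ⟨a, α⟩
    · have := ihβ (k := k) (by simpa using hk)
      simpa [cons_prefix_cons] using this
    · have aux : ∀ (v t : List ℕ) (c m : ℕ), c < m → ¬ (t ++ [m]).reverse <+: c :: v := by
        intro v t c m hlt hs
        rw [reverse_append, reverse_singleton, singleton_append, cons_prefix_cons] at hs
        omega
      have hlt := hα.lt_left (β := β)
      refine iff_of_false ?_ (aux _ _ _ _ (hlt a (by simp)))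
      obtain ⟨c, w, hw⟩ := exists_cons_of_length_eq_add_one (length_bijP (a :: α))
      rw [hw]
      refine aux _ _ _ _ ?_
      have := hα.isPerm_bijP.le (hw ▸ mem_cons_self : c ∈ bijP (a :: α))
      dsimp only
      omega

/-- If `π` or `P(π)` has the top run at one end, then so does the other, and the relabeling fixes
the entries of the run. -/
theorem Avoids231.map_topRun {π : List ℕ} (h : Avoids231 π) {k : ℕ} (hk : k ≤ π.length)
    {f : ℕ → ℕ} (hf : π.map f = bijP π)
    (ht : HasTopEnd (topRun π.length k) π ∨ HasTopEnd (topRun π.length k) (bijP π)) :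
    (topRun π.length k).map f = topRun π.length k := by
  have ht : HasTopEnd (topRun π.length k) π := ht.elim id
    (Or.imp (h.topRun_suffix_iff hk).1 (h.topRun_prefix_iff hk).1)
  rcases ht with hs | hp
  -- The run and its image under `f` are suffixes of `P(π)` of equal length.
  · exact (suffix_of_suffix_length_le (hf ▸ hs.map f) ((h.topRun_suffix_iff hk).2 hs)
      (by simp)).eq_of_length (by simp)
  · have := (prefix_of_prefix_length_le (hf ▸ hp.map f) ((h.topRun_prefix_iff hk).2 hp)
      (by simp)).eq_of_length (by simp)
    rwa [map_reverse, reverse_inj] at this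

theorem isTop_topRun {n k : ℕ} (hk : k ≤ n) {w : List ℕ} (hw : IsPerm n w) :
    IsTop (topRun n k) w := by
  refine ⟨hw.nodup, pairwise_lt_range' .., fun x hx hxt y hy => ?_⟩
  have := hw.le hx
  rw [topRun, mem_range'_1] at hxt hy
  omega

theorem topRun_subset {n k : ℕ} (hk : k ≤ n) {w : List ℕ} (hw : IsPerm n w) :
    topRun n k ⊆ w := fun x hx => by
  rw [topRun, mem_range'_1] at hx
  exact (Perm.mem_iff hw).2 (mem_range'_1.2 (by omega))

theorem sublist_map_iff_of_map_eq {f : ℕ → ℕ} {s w : List ℕ}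
    (hf : ∀ a ∈ w, ∀ b ∈ w, f a = f b → a = b) (hs : s ⊆ w) (h : s.map f = s) :
    s <+ w.map f ↔ s <+ w := by
  refine ⟨fun hsub => ?_, fun hsub => h ▸ hsub.map f⟩
  obtain ⟨l, hl, e⟩ := sublist_map_iff.1 hsub
  rw [← h] at e
  have hls : s = l := by
    refine ext_getElem (by simpa using congrArg length e) fun i h₁ h₂ => ?_
    refine hf _ (hs (getElem_mem h₁)) _ (hl.subset (getElem_mem h₂)) ?_
    simpa [h₁, h₂] using congrArg (fun v => v[i]?) e
  rwa [hls]

/-! ### The map `Φ` and subwords formed by the top run. -/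

section Phi

variable {W : List Op} {n : ℕ} {θ : List ℕ}

theorem avoids231_compose (hθ : IsPerm n θ) (h : SortedBy (stackSort ∘ compose W) θ) :
    Avoids231 (compose W θ) := by
  have hp := compose_perm W hθ.nodup
  refine avoids231_of_stackSort (hp.nodup_iff.2 hθ.nodup) ?_
  rw [hp.length_eq]
  exact h

theorem respects_relabel (hθ : IsPerm n θ) (h : SortedBy (stackSort ∘ compose W) θ) :
    Respects (relabel (compose W θ)) (compose W θ) :=
  (avoids231_compose hθ h).respects
    (map_relabel ((compose_perm W hθ.nodup).nodup_iff.2 hθ.nodup))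

theorem compose_Phi (hθ : IsPerm n θ) (h : SortedBy (stackSort ∘ compose W) θ) :
    compose W (Phi (compose W) θ) = bijP (compose W θ) := by
  rw [Phi, (respects_relabel hθ h).compose_map W hθ.nodup,
    map_relabel ((compose_perm W hθ.nodup).nodup_iff.2 hθ.nodup)]

theorem isPerm_Phi (hθ : IsPerm n θ) (h : SortedBy (stackSort ∘ compose W) θ) :
    IsPerm n (Phi (compose W) θ) := by
  have hp := compose_perm W hθ.nodup
  have := (avoids231_compose hθ h).isPerm_bijP
  rw [hp.length_eq, hθ.length_eq] at this
  refine Perm.trans ?_ this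
  rw [← map_relabel (hp.nodup_iff.2 hθ.nodup)]
  exact (hp.map _).symm

/-- A rearrangement `s` of the top run which, when it is a subword, brings the top run to an end of
the final word, is a subword of `θ` if and only if it is one of `Φ(θ)`. -/
theorem sublist_Phi_iff (hθ : IsPerm n θ) (h : SortedBy (stackSort ∘ compose W) θ)
    {k : ℕ} (hk : k ≤ n) {s : List ℕ} (hs : s.Perm (topRun n k))
    (hend : ∀ w, IsTop (topRun n k) w → s <+ w → HasTopEnd (topRun n k) (compose W w)) :
    s <+ Phi (compose W) θ ↔ s <+ θ := by
  have hp := compose_perm W hθ.nodup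
  have hlen : (compose W θ).length = n := hp.length_eq.trans hθ.length_eq
  -- A top end on either side suffices, since the subword is given in `θ` for one implication and in
  -- `Φ(θ)` for the other.
  have key : HasTopEnd (topRun n k) (compose W θ) ∨ HasTopEnd (topRun n k) (bijP (compose W θ)) →
      (s <+ Phi (compose W) θ ↔ s <+ θ) := fun ht => by
    have hfix := (avoids231_compose hθ h).map_topRun (hk.trans hlen.ge)
      (map_relabel (hp.nodup_iff.2 hθ.nodup)) (by rwa [hlen])
    rw [hlen] at hfix
    refine sublist_map_iff_of_map_eq ((respects_relabel hθ h).of_compose W hθ.nodup).injOn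
      (fun x hx => topRun_subset hk hθ (hs.mem_iff.1 hx))
      ((map_congr_left fun x hx => ?_).trans (map_id _))
    exact map_inj_left.1 (hfix.trans (map_id _).symm) x (hs.mem_iff.1 hx)
  refine ⟨fun hsub => (key (.inr ?_)).1 hsub, fun hsub => (key (.inl ?_)).2 hsub⟩
  · rw [← compose_Phi hθ h]
    exact hend _ (isTop_topRun hk (isPerm_Phi hθ h)) hsub
  · exact hend _ (isTop_topRun hk hθ) hsub

end Phi

theorem findGreatest_congr {p q : ℕ → Prop} [DecidablePred p] [DecidablePred q] {n : ℕ}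
    (h : ∀ k ≤ n, (p k ↔ q k)) : Nat.findGreatest p n = Nat.findGreatest q n := by
  induction n with
  | zero => rfl
  | succ n ih =>
    simp only [Nat.findGreatest_succ, h (n + 1) le_rfl, ih fun k hk => h k (hk.trans n.le_succ)]

end StackSort

theorem mainTheorem5 (A₀ : List StackSort.Op) (A : List ℕ → List ℕ)
    (hA : A = StackSort.compose A₀ ∘ StackSort.stackSort) :
    (∀ (n : ℕ) (θ : List ℕ), StackSort.IsPerm n θ →
        StackSort.SortedBy (StackSort.stackSort ∘ A) θ →
        StackSort.zeil (StackSort.Phi A θ) = StackSort.zeil θ) ∧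
      ([StackSort.Op.S, StackSort.Op.R] <:+: StackSort.reduce A₀ →
        ∀ (n : ℕ) (θ : List ℕ), StackSort.IsPerm n θ →
          StackSort.SortedBy (StackSort.stackSort ∘ A) θ →
          StackSort.rzeil (StackSort.Phi A θ) = StackSort.rzeil θ) := by
  have hW : A = StackSort.compose (A₀ ++ [StackSort.Op.S]) := by
    rw [hA]
    clear hA
    induction A₀ with
    | nil => rfl
    | cons X W ih => rw [StackSort.compose, Function.comp_assoc, ih]; rfl
  have hA' : ∀ w, StackSort.compose (A₀ ++ [StackSort.Op.S]) w =
      StackSort.compose A₀ (StackSort.stackSort w) := fun w => by rw [← hW, hA]; rfl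
  subst hW
  constructor
  · intro n θ hθ h
    have hl : (StackSort.Phi (StackSort.compose (A₀ ++ [StackSort.Op.S])) θ).length = n :=
      (StackSort.isPerm_Phi hθ h).length_eq
    rw [StackSort.zeil, StackSort.zeil, hl, hθ.length_eq]
    refine StackSort.findGreatest_congr fun k hk =>
      StackSort.sublist_Phi_iff hθ h hk (List.reverse_perm _) fun w hw hs => ?_
    -- The first operator `S` already turns the decreasing subword into a suffix.
    rw [hA']
    exact StackSort.HasTopEnd.compose A₀ (hw.of_perm (StackSort.stackSort_perm hw.nodup))
      (.inl (hw.suffix_stackSort_of_reverse_sublist hs))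
  · intro hSR n θ hθ h
    have hl : (StackSort.Phi (StackSort.compose (A₀ ++ [StackSort.Op.S])) θ).length = n :=
      (StackSort.isPerm_Phi hθ h).length_eq
    rw [StackSort.rzeil, StackSort.rzeil, hl, hθ.length_eq]
    refine StackSort.findGreatest_congr fun k hk =>
      StackSort.sublist_Phi_iff hθ h hk (List.Perm.refl _) fun w hw hs => ?_
    -- The first `S` only keeps the increasing subword; the top end comes from `S ∘ R` inside `A₀`.
    rw [hA']
    exact StackSort.hasTopEnd_compose_of_sublist hSR
      (hw.of_perm (StackSort.stackSort_perm hw.nodup)) (hw.sublist_stackSort hs)
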